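/- All groups are finite, and $k$ ranges over $\mathbb{N}$. Let $A$ be a finite set and $\chi_0$ a colouring of $A^k$. Colour refinement defines, for $\bar g\in A^k$, \[\chi_{i+1}(\bar g)=\bigl(\chi_i(\bar g),\{\!\!\{(\chi_i(\bar g_{|1\leftarrow x}),\dots,\chi_i(\bar g_{|k\leftarrow x}))\mid x\in A\}\!\!\}\bigr),\] where $\bar g_{|j\leftarrow x}$ is $\bar g$ with its $j$-th entry replaced by $x$ and $\{\!\!\{\cdots\}\!\!\}$ denotes a multiset. To compare two structures, they are refined in parallel; the final colouring is $\chi_i$ for the first $i$ such that $\chi_i$ and $\chi_{i+1}$ induce the same partition of all $k$-tuples of the two structures. The three versions of the $k$-dimensional Weisfeiler-Leman algorithm for groups are: Version I: colour refinement on $G^k$ where $(g_1,\dots,g_k)$ and $(h_1,\dots,h_k)$ get the same initial colour iff for all $i,j,m$: $g_i=g_j\Leftrightarrow h_i=h_j$ and $g_ig_j=g_m\Leftrightarrow h_ih_j=h_m$. Version II: colour refinement on $G^k$ where $(g_1,\dots,g_k)$ and $(h_1,\dots,h_k)$ get the same initial colour iff $g_i\mapsto h_i$ extends to an isomorphism $\langle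 g_1,\dots,g_k\rangle\to\langle h_1,\dots,h_k\rangle$. Version III (for $k\ge 2$): let $\Gamma_G$ be the graph whose vertices are the elements of $G$ and, for each $(g,h)\in G^2$, four further vertices $a_{gh},b_{gh},c_{gh},d_{gh}$, with the edges $\{g,a_{gh}\},\{h,b_{gh}\},\{gh,d_{gh}\},\{a_{gh},b_{gh}\},\{b_{gh},c_{gh}\},\{c_{gh},d_{gh}\}$. Apply colour refinement to $V(\Gamma_G)^k$, where two tuples $(v_i)$, $(w_i)$ get the same initial colour iff $v_i\mapsto w_i$ is an isomorphism of the induced subgraphs, and restrict the final colouring to $G^k$. Write $G\equiv_{WL_k^J}H$ if there is a bijection $G^k\to H^k$ preserving the final colours of Version $J$, and $WL_k^J\preceq WL_{k'}^{J'}$ if $G\equiv_{WL_{k'}^{J'}}H$ implies $G\equiv_{WL_k^J}H$ for all finite groups $G,H$. Theorem. For every $k\in\mathbb{N}$, \[WL_k^{\mathrm I}\preceq WL_k^{\mathrm{II}}\preceq WL_{\lceil k/2\rceil+2}^{\mathrm{III}}\preceq WL_{2\lceil k/2\rceil+5}^{\mathrm I}\quad\text{and}\quad WL_{\lfloor k/2\rfloor+2}^{\mathrm{III}}\preceq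 WL_{k+5}^{\mathrm I}.\] In particular, for every even $k$, $WL_k^{\mathrm I}\preceq WL_k^{\mathrm{II}}\preceq WL_{k/2+2}^{\mathrm{III}}\preceq WL_{k+5}^{\mathrm I}$. -/

import Mathlib

universe u v w

namespace GroupWL

/-! ### Colour refinement on `k`-tuples -/

/-- The colours used in round `i` of the refinement, when the initial colours lie in `C`: a colour of
round `i + 1` is a colour of round `i` together with a multiset of `k`-tuples of colours of round `i`. -/
def Color (k : ℕ) (C : Type w) : ℕ → Type w
  | 0 => C
  | i + 1 => Color k C i × Multiset (Fin k → Color k C i)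

/-- The colouring `χ_i` obtained from the initial colouring `χ₀` by `i` refinement rounds:
`χ_{i+1}(g) = (χ_i(g), {{ (χ_i(g[1 ← x]), …, χ_i(g[k ← x])) | x ∈ A }})`. -/
def refine {k : ℕ} {C : Type w} {A : Type u} [Fintype A] (χ₀ : (Fin k → A) → C) :
    (i : ℕ) → (Fin k → A) → Color k C i
  | 0, g => χ₀ g
  | i + 1, g =>
      (refine χ₀ i g,
        (Finset.univ : Finset A).val.map fun x j => refine χ₀ i (Function.update g j x))

/-- The colouring `χ_i` of all tuples of two structures `A` and `B` that are refined in parallel. -/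
def jointColoring {k : ℕ} {C : Type w} {A : Type u} {B : Type v} [Fintype A] [Fintype B]
    (χA : (Fin k → A) → C) (χB : (Fin k → B) → C) (i : ℕ) :
    (Fin k → A) ⊕ (Fin k → B) → Color k C i :=
  Sum.elim (refine χA i) (refine χB i)

/-- The first round `i` such that `χ_i` and `χ_{i+1}` induce the same partition of the tuples of the
two structures. -/
noncomputable def finalRound {k : ℕ} {C : Type w} {A : Type u} {B : Type v} [Fintype A] [Fintype B]
    (χA : (Fin k → A) → C) (χB : (Fin k → B) → C) : ℕ :=
  sInf {i | ∀ s t, jointColoring χA χB i s = jointColoring χA χB i t ↔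
    jointColoring χA χB (i + 1) s = jointColoring χA χB (i + 1) t}

/-- A tuple of `A` and a tuple of `B` have the same final colour. -/
def SameFinalColor {k : ℕ} {C : Type w} {A : Type u} {B : Type v} [Fintype A] [Fintype B]
    (χA : (Fin k → A) → C) (χB : (Fin k → B) → C) (g : Fin k → A) (h : Fin k → B) : Prop :=
  refine χA (finalRound χA χB) g = refine χB (finalRound χA χB) h

/-! ### Version I: equalities and products inside the tuple -/

/-- The initial colour of Version I: which entries are equal, and which products of two entries are
which entries. -/
def initI {k : ℕ} {G : Type u} [Group G] (g : Fin k → G) :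
    (Fin k → Fin k → Prop) × (Fin k → Fin k → Fin k → Prop) :=
  (fun i j => g i = g j, fun i j m => g i * g j = g m)

/-! ### Version II: marked isomorphism type -/

/-- A group together with a `k`-tuple of its elements. -/
structure GroupTuple (k : ℕ) where
  carrier : Type u
  [group : Group carrier]
  tuple : Fin k → carrier

attribute [instance] GroupTuple.group

/-- The map `g_i ↦ h_i` extends to an isomorphism `⟨g_1, …, g_k⟩ ≅ ⟨h_1, …, h_k⟩`. -/
def MarkedGroupIso {k : ℕ} {G : Type u} {H : Type v} [Group G] [Group H]
    (g : Fin k → G) (h : Fin k → H) : Prop :=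
  ∃ φ : Subgroup.closure (Set.range g) ≃* Subgroup.closure (Set.range h),
    ∀ i, φ ⟨g i, Subgroup.subset_closure ⟨i, rfl⟩⟩ = ⟨h i, Subgroup.subset_closure ⟨i, rfl⟩⟩

/-- Marked isomorphism as an equivalence relation. -/
def groupTupleSetoid (k : ℕ) : Setoid (GroupTuple.{u} k) where
  r s t := MarkedGroupIso s.tuple t.tuple
  iseqv :=
    { refl := fun _ => ⟨MulEquiv.refl _, fun _ => rfl⟩
      symm := fun ⟨φ, hφ⟩ => ⟨φ.symm, fun i => by rw [← hφ i, MulEquiv.symm_apply_apply]⟩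
      trans := fun ⟨φ, hφ⟩ ⟨ψ, hψ⟩ =>
        ⟨φ.trans ψ, fun i => by rw [MulEquiv.trans_apply, hφ i, hψ i]⟩ }

/-- The initial colour of Version II: the marked isomorphism type of the tuple. -/
def initII {k : ℕ} {G : Type u} [Group G] (g : Fin k → G) : Quotient (groupTupleSetoid.{u} k) :=
  Quotient.mk _ ⟨G, g⟩

/-! ### The classical algorithm for graphs, and Version III -/

/-- A simple graph together with a `k`-tuple of its vertices. -/
structure GraphTuple (k : ℕ) where
  vertex : Type u
  graph : SimpleGraph vertex
  tuple : Fin k → vertex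

/-- The map `v_i ↦ w_i` is an isomorphism of the subgraphs induced by the two tuples. -/
def MarkedGraphIso {k : ℕ} {V : Type u} {W : Type v} (Γ : SimpleGraph V) (Δ : SimpleGraph W)
    (a : Fin k → V) (b : Fin k → W) : Prop :=
  ∃ φ : Γ.induce (Set.range a) ≃g Δ.induce (Set.range b), ∀ i, φ ⟨a i, i, rfl⟩ = ⟨b i, i, rfl⟩

/-- Marked isomorphism of induced subgraphs as an equivalence relation. -/
def graphTupleSetoid (k : ℕ) : Setoid (GraphTuple.{u} k) where
  r s t := MarkedGraphIso s.graph t.graph s.tuple t.tuple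
  iseqv :=
    { refl := fun _ => ⟨RelIso.refl _, fun _ => rfl⟩
      symm := fun ⟨φ, hφ⟩ => ⟨φ.symm, fun i => by rw [← hφ i, RelIso.symm_apply_apply]⟩
      trans := fun ⟨φ, hφ⟩ ⟨ψ, hψ⟩ =>
        ⟨φ.trans ψ, fun i => by rw [RelIso.trans_apply, hφ i, hψ i]⟩ }

/-- The initial colour in the `k`-dimensional Weisfeiler-Leman algorithm for graphs (`k ≥ 2`): the
isomorphism type of the subgraph induced by the tuple, with its vertices marked by their positions. -/
def initGraph {k : ℕ} {V : Type u} (Γ : SimpleGraph V) (a : Fin k → V) :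
    Quotient (graphTupleSetoid.{u} k) :=
  Quotient.mk _ ⟨V, Γ, a⟩

/-- The vertices of `Γ_G`: the elements of `G` and, for each pair `(g, h)`, the four further nodes of
the multiplication gadget `M(g, h)`. -/
inductive Vertex (G : Type u) : Type u
  | elem (g : G)
  | a (g h : G)
  | b (g h : G)
  | c (g h : G)
  | d (g h : G)
  deriving Fintype

/-- The edges of the multiplication gadgets `M(g, h)`, each in one direction. -/
inductive GadgetEdge {G : Type u} [Group G] : Vertex G → Vertex G → Prop
  | left (g h : G) : GadgetEdge (.elem g) (.a g h)
  | right (g h : G) : GadgetEdge (.elem h) (.b g h)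
  | prod (g h : G) : GadgetEdge (.elem (g * h)) (.d g h)
  | ab (g h : G) : GadgetEdge (.a g h) (.b g h)
  | bc (g h : G) : GadgetEdge (.b g h) (.c g h)
  | cd (g h : G) : GadgetEdge (.c g h) (.d g h)

/-- The graph `Γ_G`. -/
def gadgetGraph (G : Type u) [Group G] : SimpleGraph (Vertex G) :=
  SimpleGraph.fromRel GadgetEdge

/-! ### Equivalence and comparison of the versions -/

/-- The three versions of the Weisfeiler-Leman algorithm for groups. -/
inductive Version
  | I
  | II
  | III

/-- `G ≡ H` with respect to the `k`-dimensional algorithm in the given version: there is a bijection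
`G^k → H^k` that preserves final colours. In Version III the tuples of group elements are coloured by
the algorithm for graphs, run on all `k`-tuples of vertices of `Γ_G` and of `Γ_H`. -/
def WLEquiv (J : Version) (k : ℕ) (G H : Type u) [Group G] [Group H] [Fintype G] [Fintype H] : Prop :=
  match J with
  | .I => ∃ f : (Fin k → G) ≃ (Fin k → H), ∀ g,
      SameFinalColor (initI (k := k) (G := G)) (initI (k := k) (G := H)) g (f g)
  | .II => ∃ f : (Fin k → G) ≃ (Fin k → H), ∀ g,
      SameFinalColor (initII (k := k) (G := G)) (initII (k := k) (G := H)) g (f g)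
  | .III => ∃ f : (Fin k → G) ≃ (Fin k → H), ∀ g,
      SameFinalColor (initGraph (k := k) (gadgetGraph G)) (initGraph (k := k) (gadgetGraph H))
        (fun i => Vertex.elem (g i)) (fun i => Vertex.elem (f g i))

/-- `WL_k^J ⪯ WL_{k'}^{J'}`: finite groups that are equivalent with respect to `WL_{k'}^{J'}` are
equivalent with respect to `WL_k^J`. -/
def WLLe (J : Version) (k : ℕ) (J' : Version) (k' : ℕ) : Prop :=
  ∀ (G H : Type u) [Group G] [Group H] [Fintype G] [Fintype H],
    WLEquiv J' k' G H → WLEquiv J k G H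

end GroupWL

/-! Colour refinement on `k`-tuples is a bijective game. A relation between tuples is a
back-and-forth system if at each related pair one bijection of the structures answers every
replacement of an entry, at every position. "Same final colour" is itself such a system, and it
contains every such system that respects the initial colours (`BackForth.sameColors`,
`backForth_sameColors`). One related pair already yields a bijection of all tuples
(`BackForth.exists_equiv`). Comparing two versions thus means turning a strategy for one game into a
strategy for the other.

I below II: marked isomorphic tuples satisfy the same equations.

III below I: a vertex of `Γ_G` is its shape together with two group elements, so `2 * n` group
positions code `n` vertices. One spare position holds the first element of a pair while the second
is being answered (`CodedRel.exists_shear`), hence dimension `2 * n + 1`.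

II below III: conversely, the middle vertex of a gadget stores a pair of group elements, so `m`
vertices hold up to `2 * m` elements, and two more positions serve as workspace. Vertex degrees
separate elements, middle vertices and the rest, and short paths recover the two factors and the
product of a pair. With the workspace one can evaluate every word in the stored elements
(`eq_lift_iff`), so the stored tuples satisfy the same relations and are marked isomorphic; it also
allows one element of a stored pair to be replaced while the other is kept (`backForth_marks`). -/

namespace GroupWL

/-! ### Colour refinement as a back-and-forth relation -/

section Refinement

variable {k : ℕ} {C : Type w} {A : Type u} {B : Type v}

/-- The two tuples have the same colour in every round. -/
def SameColors [Fintype A] [Fintype B] (χA : (Fin k → A) → C) (χB : (Fin k → B) → C)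
    (g : Fin k → A) (h : Fin k → B) : Prop :=
  ∀ i, refine χA i g = refine χB i h

/-- Duplicator can answer every move of the bijective pebble game on `k`-tuples without leaving `R`. -/
def BackForth (R : (Fin k → A) → (Fin k → B) → Prop) : Prop :=
  ∀ g h, R g h → ∃ f : A ≃ B, ∀ x j, R (Function.update g j x) (Function.update h j (f x))

theorem map_univ_eq_of_equiv [Fintype A] [Fintype B] {D : Type*} (p : A → D) (q : B → D)
    (f : A ≃ B) (hf : ∀ x, p x = q (f x)) :
    (Finset.univ : Finset A).val.map p = (Finset.univ : Finset B).val.map q := by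
  have : p = q ∘ f := funext hf
  rw [this, ← Multiset.map_map, ← Finset.map_univ_equiv f]
  simp

/-- Equal multisets of values have equal multiplicities, so corresponding fibres are equinumerous
and bijections between them glue. -/
theorem exists_equiv_of_map_univ_eq [Fintype A] [Fintype B] {D : Type*} (p : A → D) (q : B → D)
    (h : (Finset.univ : Finset A).val.map p = (Finset.univ : Finset B).val.map q) :
    ∃ f : A ≃ B, ∀ x, p x = q (f x) := by
  classical
  have hc : ∀ c, Nonempty ({x // p x = c} ≃ {y // q y = c}) := by
    intro c
    refine ⟨Fintype.equivOfCardEq ?_⟩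
    have := congrArg (Multiset.count c) h
    rw [Multiset.count_map, Multiset.count_map] at this
    rw [Fintype.card_subtype, Fintype.card_subtype]
    simpa only [eq_comm, Finset.card, Finset.filter_val] using this
  exact ⟨Equiv.ofFiberEquiv fun c => (hc c).some, fun x => (Equiv.ofFiberEquiv_map _ x).symm⟩

variable [Fintype A] [Fintype B] {χA : (Fin k → A) → C} {χB : (Fin k → B) → C}

theorem BackForth.sameColors {R : (Fin k → A) → (Fin k → B) → Prop} (hR : BackForth R)
    (h0 : ∀ g h, R g h → χA g = χB h) {g : Fin k → A} {h : Fin k → B} (hgh : R g h) :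
    SameColors χA χB g h := by
  intro i
  induction i generalizing g h with
  | zero => exact h0 g h hgh
  | succ i ih =>
    obtain ⟨f, hf⟩ := hR g h hgh
    exact Prod.ext (ih hgh) (map_univ_eq_of_equiv _ _ f fun x => funext fun j => ih (hf x j))

theorem jointColoring_of_succ {i : ℕ} {s t : (Fin k → A) ⊕ (Fin k → B)}
    (h : jointColoring χA χB (i + 1) s = jointColoring χA χB (i + 1) t) :
    jointColoring χA χB i s = jointColoring χA χB i t := by
  rcases s with s | s <;> rcases t with t | t <;> exact congrArg Prod.fst h

/-- If round `i + 1` splits no class, its colours are a function `φ` of the colours of round `i`.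
Applying `φ` inside the multiset then computes the next colour from that of round `i + 1`, so
stability persists. -/
theorem jointColoring_stable_succ {i : ℕ}
    (hi : ∀ s t, jointColoring χA χB i s = jointColoring χA χB i t →
      jointColoring χA χB (i + 1) s = jointColoring χA χB (i + 1) t)
    (s t : (Fin k → A) ⊕ (Fin k → B))
    (h : jointColoring χA χB (i + 1) s = jointColoring χA χB (i + 1) t) :
    jointColoring χA χB (i + 2) s = jointColoring χA χB (i + 2) t := by
  obtain ⟨φ, hφ⟩ : ∃ φ : Color k C i → Color k C (i + 1),
      jointColoring χA χB (i + 1) = φ ∘ jointColoring χA χB i :=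
    haveI : Nonempty (Color k C (i + 1)) := ⟨jointColoring χA χB (i + 1) s⟩
    (Function.factorsThrough_iff _).1 fun a b hab => hi a b hab
  have hA : ∀ g, refine χA (i + 1) g = φ (refine χA i g) := fun g => congrFun hφ (.inl g)
  have hB : ∀ g, refine χB (i + 1) g = φ (refine χB i g) := fun g => congrFun hφ (.inr g)
  have key : ∀ s, jointColoring χA χB (i + 2) s = (jointColoring χA χB (i + 1) s,
      (jointColoring χA χB (i + 1) s).2.map fun c j => φ (c j)) := by
    rintro (g | g)
    · refine Prod.ext rfl ?_
      change Multiset.map _ _ = Multiset.map _ (Multiset.map _ _)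
      rw [Multiset.map_map]
      exact congrArg (Multiset.map · _) (funext fun x => funext fun j => hA _)
    · refine Prod.ext rfl ?_
      change Multiset.map _ _ = Multiset.map _ (Multiset.map _ _)
      rw [Multiset.map_map]
      exact congrArg (Multiset.map · _) (funext fun x => funext fun j => hB _)
  rw [key, key, h]

variable (χA χB) in
theorem exists_stable_round : ∃ i, ∀ s t, jointColoring χA χB i s = jointColoring χA χB i t ↔
    jointColoring χA χB (i + 1) s = jointColoring χA χB (i + 1) t := by
  classical
  let T := (Fin k → A) ⊕ (Fin k → B)
  let a : ℕ →o Set (T × T) :=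
    ⟨fun i => {p | jointColoring χA χB i p.1 ≠ jointColoring χA χB i p.2},
      -- The sets of distinguished pairs increase with the round, inside a finite set.
      monotone_nat_of_le_succ fun i p hp h => hp (jointColoring_of_succ h)⟩
  obtain ⟨n, hn⟩ := WellFoundedGT.monotone_chain_condition a
  refine ⟨n, fun s t => not_iff_not.1 ?_⟩
  have := Set.ext_iff.1 (hn (n + 1) n.le_succ) (s, t)
  exact this

theorem SameFinalColor.sameColors {g : Fin k → A} {h : Fin k → B}
    (hgh : SameFinalColor χA χB g h) : SameColors χA χB g h := by
  have hst : ∀ s t, jointColoring χA χB (finalRound χA χB) s =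
      jointColoring χA χB (finalRound χA χB) t ↔
      jointColoring χA χB (finalRound χA χB + 1) s = jointColoring χA χB (finalRound χA χB + 1) t :=
    Nat.sInf_mem (exists_stable_round χA χB)
  have hfin : jointColoring χA χB (finalRound χA χB) (.inl g) =
    jointColoring χA χB (finalRound χA χB) (.inr h) := hgh
  generalize finalRound χA χB = r at hst hfin
  have up : ∀ n, (∀ s t, jointColoring χA χB (r + n) s = jointColoring χA χB (r + n) t →
      jointColoring χA χB (r + n + 1) s = jointColoring χA χB (r + n + 1) t) ∧
      jointColoring χA χB (r + n) (.inl g) = jointColoring χA χB (r + n) (.inr h) := by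
    intro n
    induction n with
    | zero => exact ⟨fun s t => (hst s t).1, hfin⟩
    | succ n ih => exact ⟨jointColoring_stable_succ ih.1, ih.1 _ _ ih.2⟩
  have down : ∀ n i, jointColoring χA χB (i + n) (.inl g) = jointColoring χA χB (i + n) (.inr h) →
      jointColoring χA χB i (.inl g) = jointColoring χA χB i (.inr h) := by
    intro n
    induction n with
    | zero => exact fun i hi => hi
    | succ n ih => exact fun i hi => ih i (jointColoring_of_succ hi)
  intro i
  refine down r i ?_
  rw [add_comm]
  exact (up i).2

theorem SameColors.sameFinalColor {g : Fin k → A} {h : Fin k → B}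
    (hgh : SameColors χA χB g h) : SameFinalColor χA χB g h :=
  hgh _

theorem SameColors.initial_eq {g : Fin k → A} {h : Fin k → B}
    (hgh : SameColors χA χB g h) : χA g = χB h :=
  hgh 0

theorem backForth_sameColors : BackForth (SameColors χA χB) := by
  intro g h hgh
  -- The multiset in round `finalRound + 1` consists of final colours, so a single bijection serves
  -- all rounds at once.
  obtain ⟨f, hf⟩ := exists_equiv_of_map_univ_eq _ _
    (congrArg Prod.snd (hgh (finalRound χA χB + 1)))
  exact ⟨f, fun x j => SameFinalColor.sameColors (congrFun (hf x) j)⟩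

end Refinement

/-- Playing the game at all positions in turn gives a bijection of the tuples inside `R`. -/
theorem BackForth.exists_equiv {k : ℕ} {A : Type u} {B : Type v}
    {R : (Fin k → A) → (Fin k → B) → Prop} (hR : BackForth R) {g : Fin k → A} {h : Fin k → B}
    (hgh : R g h) : ∃ F : (Fin k → A) ≃ (Fin k → B), ∀ u, R u (F u) := by
  have key : ∀ n, n ≤ k → ∃ F : (Fin n → A) ≃ (Fin n → B), ∀ u,
      R (fun i => if hi : i.1 < n then u ⟨i, hi⟩ else g i)
        (fun i => if hi : i.1 < n then F u ⟨i, hi⟩ else h i) := by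
    intro n
    induction n with
    | zero => exact fun _ => ⟨Equiv.ofUnique _ _, fun u => by simpa using hgh⟩
    | succ n ih =>
      intro hn
      obtain ⟨F, hF⟩ := ih (Nat.le_of_succ_le hn)
      choose f hf using fun u => hR _ _ (hF u)
      let eA : (Fin (n + 1) → A) ≃ (Fin n → A) × A :=
        ⟨fun u => (Fin.init u, u (Fin.last n)), fun p => Fin.snoc p.1 p.2, fun u => by simp,
          fun p => by simp⟩
      let eB : (Fin n → B) × B ≃ (Fin (n + 1) → B) :=
        ⟨fun p => Fin.snoc p.1 p.2, fun u => (Fin.init u, u (Fin.last n)), fun p => by simp,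
          fun u => by simp⟩
      -- The answer at position `n` depends on the entries played before, so the extended bijection
      -- is a shear.
      refine ⟨eA.trans ((Equiv.prodShear F f).trans eB), fun u => ?_⟩
      have := hf (Fin.init u) (u (Fin.last n)) ⟨n, hn⟩
      convert this using 1
      · funext i
        rcases lt_trichotomy i.1 n with hi | hi | hi
        · have h1 : i ≠ ⟨n, hn⟩ := fun h => hi.ne (congrArg Fin.val h)
          simp [h1, hi, Nat.lt_succ_of_lt hi, Fin.init]
        · obtain rfl : i = ⟨n, hn⟩ := Fin.ext hi
          simp [Fin.last]
        · have h1 : i ≠ ⟨n, hn⟩ := fun h => hi.ne' (congrArg Fin.val h)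
          have h2 : ¬ i.1 < n + 1 := by omega
          simp [h1, h2, hi.not_gt]
      · funext i
        rcases lt_trichotomy i.1 n with hi | hi | hi
        · have h1 : i ≠ ⟨n, hn⟩ := fun h => hi.ne (congrArg Fin.val h)
          simp [h1, hi, Nat.lt_succ_of_lt hi, eA, eB, Fin.snoc]
        · obtain rfl : i = ⟨n, hn⟩ := Fin.ext hi
          simp [eA, eB, Fin.snoc]
        · have h1 : i ≠ ⟨n, hn⟩ := fun h => hi.ne' (congrArg Fin.val h)
          have h2 : ¬ i.1 < n + 1 := by omega
          simp [h1, h2, hi.not_gt]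
  obtain ⟨F, hF⟩ := key k le_rfl
  exact ⟨F, fun u => by simpa using hF u⟩

/-! ### Marked isomorphisms -/

theorem MarkedGroupIso.initI_eq {k : ℕ} {G : Type u} {H : Type v} [Group G] [Group H]
    {g : Fin k → G} {h : Fin k → H} (hgh : MarkedGroupIso g h) : initI g = initI h := by
  obtain ⟨φ, hφ⟩ := hgh
  have hm : ∀ i, g i ∈ Subgroup.closure (Set.range g) := fun i => Subgroup.subset_closure ⟨i, rfl⟩
  refine Prod.ext ?_ ?_
  · funext i j
    have := φ.apply_eq_iff_eq (x := ⟨g i, hm i⟩) (y := ⟨g j, hm j⟩)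
    rw [hφ, hφ, Subtype.mk_eq_mk, Subtype.mk_eq_mk] at this
    exact propext this.symm
  · funext i j m
    have := φ.apply_eq_iff_eq (x := ⟨g i, hm i⟩ * ⟨g j, hm j⟩) (y := ⟨g m, hm m⟩)
    rw [map_mul, hφ, hφ, hφ, MulMemClass.mk_mul_mk, MulMemClass.mk_mul_mk, Subtype.mk_eq_mk,
      Subtype.mk_eq_mk] at this
    exact propext this.symm

/-- Two tuples that satisfy the same relations generate isomorphic subgroups. -/
theorem markedGroupIso_of_relations {k : ℕ} {G : Type u} {H : Type v} [Group G] [Group H]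
    {g : Fin k → G} {h : Fin k → H}
    (hgh : ∀ r : FreeGroup (Fin k), FreeGroup.lift g r = 1 ↔ FreeGroup.lift h r = 1) :
    MarkedGroupIso g h := by
  -- Both generated subgroups are quotients of the free group by the same kernel.
  have hker : (FreeGroup.lift g).ker = (FreeGroup.lift h).ker := Subgroup.ext hgh
  let φ := ((MulEquiv.subgroupCongr FreeGroup.range_lift_eq_closure.symm).trans
    (QuotientGroup.quotientKerEquivRange (FreeGroup.lift g)).symm).trans
    ((QuotientGroup.quotientMulEquivOfEq hker).trans
      ((QuotientGroup.quotientKerEquivRange (FreeGroup.lift h)).trans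
        (MulEquiv.subgroupCongr FreeGroup.range_lift_eq_closure)))
  refine ⟨φ, fun i => ?_⟩
  have : (QuotientGroup.quotientKerEquivRange (FreeGroup.lift g)).symm
      (MulEquiv.subgroupCongr FreeGroup.range_lift_eq_closure.symm
        ⟨g i, Subgroup.subset_closure ⟨i, rfl⟩⟩) = QuotientGroup.mk (FreeGroup.of i) := by
    rw [MulEquiv.symm_apply_eq]
    exact Subtype.ext FreeGroup.lift_apply_of.symm
  simp only [φ, MulEquiv.trans_apply, this, QuotientGroup.quotientMulEquivOfEq_mk]
  exact Subtype.ext FreeGroup.lift_apply_of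

theorem initII_eq_iff {k : ℕ} {G H : Type u} [Group G] [Group H] {g : Fin k → G} {h : Fin k → H} :
    initII g = initII h ↔ MarkedGroupIso g h :=
  Quotient.eq (r := groupTupleSetoid k)

theorem initGraph_eq_iff {k : ℕ} {V W : Type u} {Γ : SimpleGraph V} {Δ : SimpleGraph W}
    {a : Fin k → V} {b : Fin k → W} :
    initGraph Γ a = initGraph Δ b ↔ MarkedGraphIso Γ Δ a b :=
  Quotient.eq (r := graphTupleSetoid k)

theorem markedGraphIso_iff {k : ℕ} {V : Type u} {W : Type v} {Γ : SimpleGraph V}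
    {Δ : SimpleGraph W} {a : Fin k → V} {b : Fin k → W} :
    MarkedGraphIso Γ Δ a b ↔
      ∀ i j, (a i = a j ↔ b i = b j) ∧ (Γ.Adj (a i) (a j) ↔ Δ.Adj (b i) (b j)) := by
  constructor
  · rintro ⟨φ, hφ⟩ i j
    constructor
    · have := φ.injective.eq_iff (a := ⟨a i, i, rfl⟩) (b := ⟨a j, j, rfl⟩)
      rw [hφ, hφ] at this
      exact Subtype.ext_iff.symm.trans (this.symm.trans Subtype.ext_iff)
    · have := φ.map_rel_iff (a := ⟨a i, i, rfl⟩) (b := ⟨a j, j, rfl⟩)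
      rw [hφ, hφ] at this
      exact this.symm
  · intro h
    choose p hp using fun x : Set.range a => x.2
    choose q hq using fun y : Set.range b => y.2
    have hpb : ∀ i, b (p ⟨a i, i, rfl⟩) = b i := fun i => (h _ _).1.1 (hp ⟨a i, i, rfl⟩)
    have hqa : ∀ i, a (q ⟨b i, i, rfl⟩) = a i := fun i => (h _ _).1.2 (hq ⟨b i, i, rfl⟩)
    refine ⟨⟨⟨fun x => ⟨b (p x), p x, rfl⟩, fun y => ⟨a (q y), q y, rfl⟩, fun x => ?_, fun y => ?_⟩,
      fun {x y} => ?_⟩, fun i => Subtype.ext (hpb i)⟩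
    · exact Subtype.ext ((hqa _).trans (hp x))
    · exact Subtype.ext ((hpb _).trans (hq y))
    · change Δ.Adj (b (p x)) (b (p y)) ↔ Γ.Adj x.1 y.1
      rw [← (h _ _).2, hp, hp]

theorem wlLe_I_II (k : ℕ) : WLLe.{u} .I k .II k := by
  rintro G H _ _ _ _ ⟨f, hf⟩
  exact ⟨f, fun g => (backForth_sameColors.sameColors
    (fun g h hgh => (initII_eq_iff.1 hgh.initial_eq).initI_eq) (hf g).sameColors).sameFinalColor⟩

/-! ### The gadget graph -/

/-- The edges of the gadgets, by the shape of their end points. -/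
def Vertex.Edge {G : Type u} [Group G] : Vertex G → Vertex G → Prop
  | .elem x, .a g _ => x = g
  | .elem x, .b _ h => x = h
  | .elem x, .d g h => g * h = x
  | .a g h, .b g' h' => g = g' ∧ h = h'
  | .b g h, .c g' h' => g = g' ∧ h = h'
  | .c g h, .d g' h' => g = g' ∧ h = h'
  | _, _ => False

theorem gadgetEdge_iff {G : Type u} [Group G] {v w : Vertex G} : GadgetEdge v w ↔ v.Edge w := by
  constructor
  · rintro (_ | _ | _ | _ | _ | _) <;> simp [Vertex.Edge]
  · cases v <;> cases w <;> simp only [Vertex.Edge, false_imp_iff] <;>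
      first
        | (rintro rfl; constructor)
        | (rintro ⟨rfl, rfl⟩; constructor)

theorem gadgetGraph_adj {G : Type u} [Group G] {v w : Vertex G} :
    (gadgetGraph G).Adj v w ↔ v.Edge w ∨ w.Edge v := by
  rw [gadgetGraph, SimpleGraph.fromRel_adj, gadgetEdge_iff, gadgetEdge_iff, and_iff_right_iff_imp]
  rintro h rfl
  cases v <;> simp [Vertex.Edge] at h

/-! ### Version III is bounded by Version I -/

/-- `v` and `w` have the same shape, the vertex `v` is described by the two elements `g₀`, `g₁` and
the vertex `w` by `h₀`, `h₁`. -/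
inductive Vertex.Coded {G H : Type u} (g₀ g₁ : G) (h₀ h₁ : H) : Vertex G → Vertex H → Prop
  | elem (hg : g₀ = g₁) (hh : h₀ = h₁) : Coded g₀ g₁ h₀ h₁ (.elem g₀) (.elem h₀)
  | a : Coded g₀ g₁ h₀ h₁ (.a g₀ g₁) (.a h₀ h₁)
  | b : Coded g₀ g₁ h₀ h₁ (.b g₀ g₁) (.b h₀ h₁)
  | c : Coded g₀ g₁ h₀ h₁ (.c g₀ g₁) (.c h₀ h₁)
  | d : Coded g₀ g₁ h₀ h₁ (.d g₀ g₁) (.d h₀ h₁)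

theorem initI_eq_iff {k : ℕ} {G : Type u} {H : Type v} [Group G] [Group H]
    {g : Fin k → G} {h : Fin k → H} :
    initI g = initI h ↔ (∀ i j, g i = g j ↔ h i = h j) ∧
      ∀ i j m, g i * g j = g m ↔ h i * h j = h m := by
  simp [initI, Prod.ext_iff, funext_iff]

section

variable {G H : Type u} [Group G] [Group H]

theorem Vertex.Coded.eq_iff {K : ℕ} {g : Fin K → G} {h : Fin K → H} (hgh : initI g = initI h)
    {p q r s : Fin K} {v v' : Vertex G} {w w' : Vertex H}
    (hv : Coded (g p) (g q) (h p) (h q) v w) (hv' : Coded (g r) (g s) (h r) (h s) v' w') :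
    v = v' ↔ w = w' := by
  obtain ⟨he, -⟩ := initI_eq_iff.1 hgh
  cases hv <;> cases hv' <;> simp [he]

theorem Vertex.Coded.edge_iff {K : ℕ} {g : Fin K → G} {h : Fin K → H} (hgh : initI g = initI h)
    {p q r s : Fin K} {v v' : Vertex G} {w w' : Vertex H}
    (hv : Coded (g p) (g q) (h p) (h q) v w) (hv' : Coded (g r) (g s) (h r) (h s) v' w') :
    v.Edge v' ↔ w.Edge w' := by
  obtain ⟨he, hm⟩ := initI_eq_iff.1 hgh
  cases hv <;> cases hv' <;> simp [Vertex.Edge, he, hm]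

/-- The bijection of vertices given by a bijection for the first and bijections for the second
element of a pair. -/
def Vertex.equivOfShear (f : G ≃ H) (f₂ : G → (G ≃ H)) : Vertex G ≃ Vertex H where
  toFun
    | .elem x => .elem (f x)
    | .a x y => .a (f x) (f₂ x y)
    | .b x y => .b (f x) (f₂ x y)
    | .c x y => .c (f x) (f₂ x y)
    | .d x y => .d (f x) (f₂ x y)
  invFun
    | .elem x => .elem (f.symm x)
    | .a x y => .a (f.symm x) ((f₂ (f.symm x)).symm y)
    | .b x y => .b (f.symm x) ((f₂ (f.symm x)).symm y)
    | .c x y => .c (f.symm x) ((f₂ (f.symm x)).symm y)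
    | .d x y => .d (f.symm x) ((f₂ (f.symm x)).symm y)
  left_inv v := by cases v <;> simp
  right_inv v := by cases v <;> simp

/-- The tuples of vertices `v`, `w` are coded by tuples of group elements in `R`, the code of the
`i`-th vertex standing at the positions `e (i, false)` and `e (i, true)`. -/
def CodedRel {n K : ℕ} (e : Fin n × Bool → Fin K) (R : (Fin K → G) → (Fin K → H) → Prop)
    (v : Fin n → Vertex G) (w : Fin n → Vertex H) : Prop :=
  ∃ g h, R g h ∧ ∀ i, Vertex.Coded (g (e (i, false))) (g (e (i, true)))
    (h (e (i, false))) (h (e (i, true))) (v i) (w i)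

theorem CodedRel.initGraph_eq {n K : ℕ} {e : Fin n × Bool → Fin K}
    {R : (Fin K → G) → (Fin K → H) → Prop} (h0 : ∀ g h, R g h → initI g = initI h)
    {v : Fin n → Vertex G} {w : Fin n → Vertex H} (hvw : CodedRel e R v w) :
    initGraph (gadgetGraph G) v = initGraph (gadgetGraph H) w := by
  obtain ⟨g, h, hgh, hc⟩ := hvw
  have := h0 g h hgh
  rw [initGraph_eq_iff, markedGraphIso_iff]
  intro i j
  refine ⟨(hc i).eq_iff this (hc j), ?_⟩
  rw [gadgetGraph_adj, gadgetGraph_adj, (hc i).edge_iff this (hc j), (hc j).edge_iff this (hc i)]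

/-- The bijection of vertices must be fixed before the position `j` is known. So the first element
is parked at the spare position `p`, outside all codes, and the second is answered from there by `f₂
x`; only then are both copied to the code of `j`. -/
theorem CodedRel.exists_shear {n K : ℕ} {e : Fin n × Bool → Fin K} (he : e.Injective)
    {p : Fin K} (hp : ∀ c, e c ≠ p)
    {R : (Fin K → G) → (Fin K → H) → Prop} (hR : BackForth R)
    (h0 : ∀ g h, R g h → initI g = initI h)
    {v : Fin n → Vertex G} {w : Fin n → Vertex H} (hvw : CodedRel e R v w) :
    ∃ (f : G ≃ H) (f₂ : G → (G ≃ H)), ∀ x j,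
      CodedRel e R (Function.update v j x)
        (Function.update w j (Vertex.equivOfShear f f₂ x)) := by
  obtain ⟨g, h, hgh, hc⟩ := hvw
  obtain ⟨f, hf⟩ := hR g h hgh
  choose f₂ hf₂ using fun x => hR _ _ (hf x p)
  -- the pair `(x, y)` can be placed at the code of the `j`-th vertex
  have key : ∀ x y j, ∃ g' h', R g' h' ∧ g' (e (j, false)) = x ∧ g' (e (j, true)) = y ∧
      h' (e (j, false)) = f x ∧ h' (e (j, true)) = f₂ x y ∧
      ∀ i ≠ j, ∀ t, g' (e (i, t)) = g (e (i, t)) ∧ h' (e (i, t)) = h (e (i, t)) := by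
    intro x y j
    obtain ⟨f₃, hf₃⟩ := hR _ _ (hf₂ x y (e (j, true)))
    have h3 := hf₃ x (e (j, false))
    have hne : e (j, false) ≠ e (j, true) := fun h => by simpa using he h
    -- Position `p` still holds `x`, answered by `f x`, and initial colours detect equal entries.
    have hx : f₃ x = f x := by
      have := ((initI_eq_iff.1 (h0 _ _ h3)).1 (e (j, false)) p).1 (by simp [(hp _).symm])
      simpa [(hp _).symm] using this
    refine ⟨_, _, h3, ?_, ?_, ?_, ?_, ?_⟩
    · simp
    · simp [hne.symm]
    · simp [hx]
    · simp [hne.symm]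
    · intro i hi t
      have h1 : ∀ s, e (i, t) ≠ e (j, s) := fun s h => hi (congrArg Prod.fst (he h))
      simp [h1, hp]
  -- Needed for group elements, which are coded by a repeated entry; `n ≠ 0` supplies a position
  -- other than `p`.
  have hdiag : ∀ x, n ≠ 0 → f₂ x x = f x := by
    intro x hn
    have h3 := hf₂ x x (e (⟨0, Nat.pos_of_ne_zero hn⟩, false))
    have := ((initI_eq_iff.1 (h0 _ _ h3)).1 (e (⟨0, Nat.pos_of_ne_zero hn⟩, false)) p).1
      (by simp [(hp _).symm])
    simpa [(hp _).symm] using this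
  have place : ∀ x y j V W, Vertex.Coded x y (f x) (f₂ x y) V W →
      CodedRel e R (Function.update v j V) (Function.update w j W) := by
    intro x y j V W hVW
    obtain ⟨g', h', hR', h1, h2, h3, h4, h5⟩ := key x y j
    refine ⟨g', h', hR', fun i => ?_⟩
    by_cases hi : i = j
    · subst hi
      simpa [h1, h2, h3, h4] using hVW
    · simpa [hi, (h5 i hi _).1, (h5 i hi _).2] using hc i
  refine ⟨f, f₂, fun x j => ?_⟩
  cases x with
  | elem x =>
    exact place x x j _ _ (.elem rfl (hdiag x (by have := j.2; omega)).symm)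
  | a x y => exact place x y j _ _ .a
  | b x y => exact place x y j _ _ .b
  | c x y => exact place x y j _ _ .c
  | d x y => exact place x y j _ _ .d

end

theorem wlLe_III_I {n K : ℕ} (hK : 2 * n + 1 ≤ K) : WLLe.{u} .III n .I K := by
  rintro G H _ _ _ _ ⟨F, hF⟩
  let e : Fin n × Bool → Fin K := fun c =>
    ⟨2 * c.1 + c.2.toNat, by have := c.1.2; have := c.2.toNat_le; omega⟩
  have he : e.Injective := by
    rintro ⟨i, s⟩ ⟨j, t⟩ h
    have h' : 2 * i.1 + s.toNat = 2 * j.1 + t.toNat := congrArg Fin.val h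
    have : i.1 = j.1 ∧ s.toNat = t.toNat := by
      have := s.toNat_le
      have := t.toNat_le
      omega
    rw [Prod.mk.injEq]
    exact ⟨Fin.ext this.1, by revert this; cases s <;> cases t <;> simp⟩
  let p : Fin K := ⟨2 * n, by omega⟩
  have hp : ∀ c, e c ≠ p := by
    intro c h
    have h' : 2 * c.1.1 + c.2.toNat = 2 * n := congrArg Fin.val h
    have := c.1.2
    have := c.2.toNat_le
    omega
  let R : (Fin K → G) → (Fin K → H) → Prop := SameColors initI initI
  have hR : BackForth R := backForth_sameColors
  have h0 : ∀ g h, R g h → initI g = initI h := fun g h hgh => hgh.initial_eq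
  have hbf : BackForth (CodedRel (n := n) e R) := fun v w hvw =>
    have ⟨f, f₂, hf⟩ := hvw.exists_shear he hp hR h0
    ⟨Vertex.equivOfShear f f₂, hf⟩
  -- The required bijection is one of group tuples, and `Vertex.equivOfShear` maps elements to
  -- elements.
  have hbf' : BackForth fun (g : Fin n → G) (h : Fin n → H) =>
      CodedRel e R (fun i => .elem (g i)) (fun i => .elem (h i)) := by
    intro g h hgh
    obtain ⟨f, f₂, hf⟩ := hgh.exists_shear he hp hR h0
    refine ⟨f, fun x j => ?_⟩
    convert hf (.elem x) j using 1
    · exact Function.comp_update Vertex.elem g j x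
    · exact Function.comp_update Vertex.elem h j (f x)
  -- A constant tuple can only be answered by a constant tuple; its value is irrelevant.
  have hone : ∀ i j, F 1 i = F 1 j := fun i j =>
    ((initI_eq_iff.1 (hF 1).sameColors.initial_eq).1 i j).1 rfl
  have hstart : CodedRel e R (fun _ => .elem 1) (fun _ => .elem (F 1 p)) := by
    refine ⟨1, F 1, (hF 1).sameColors, fun i => ?_⟩
    rw [hone p (e (i, false))]
    exact .elem rfl (hone _ _)
  obtain ⟨E, hE⟩ := hbf'.exists_equiv (g := fun _ => 1) (h := fun _ => F 1 p) hstart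
  exact ⟨E, fun g => (hbf.sameColors (fun v w hvw => hvw.initGraph_eq h0) (hE g)).sameFinalColor⟩

/-! ### Relations of vertices that Version III detects -/

section Preserved

variable {n : ℕ} {V : Type u} {W : Type v}

/-- `R` is a winning strategy of Duplicator in the bijective game on the `n`-tuples of vertices of two
graphs. -/
structure GraphStrategy (Γ : SimpleGraph V) (Δ : SimpleGraph W)
    (R : (Fin n → V) → (Fin n → W) → Prop) : Prop where
  backForth : BackForth R
  eq_iff : ∀ {v w}, R v w → ∀ i j, v i = v j ↔ w i = w j
  adj_iff : ∀ {v w}, R v w → ∀ i j, Γ.Adj (v i) (v j) ↔ Δ.Adj (w i) (w j)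

/-- Tuples related by `R` agree on the properties `P`, `Q` at every position. -/
def Preserves₁ (R : (Fin n → V) → (Fin n → W) → Prop) (P : V → Prop) (Q : W → Prop) : Prop :=
  ∀ v w, R v w → ∀ i, P (v i) ↔ Q (w i)

/-- Tuples related by `R` agree on the relations `P`, `Q` at any two different positions. -/
def Preserves₂ (R : (Fin n → V) → (Fin n → W) → Prop) (P : V → V → Prop) (Q : W → W → Prop) :
    Prop :=
  ∀ v w, R v w → ∀ i j, i ≠ j → (P (v i) (v j) ↔ Q (w i) (w j))

variable {R : (Fin n → V) → (Fin n → W) → Prop}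

theorem Preserves₁.not {P : V → Prop} {Q : W → Prop} (h : Preserves₁ R P Q) :
    Preserves₁ R (fun x => ¬ P x) (fun x => ¬ Q x) :=
  fun v w hvw i => not_congr (h v w hvw i)

theorem Preserves₁.and {P P' : V → Prop} {Q Q' : W → Prop} (h : Preserves₁ R P Q)
    (h' : Preserves₁ R P' Q') : Preserves₁ R (fun x => P x ∧ P' x) (fun x => Q x ∧ Q' x) :=
  fun v w hvw i => and_congr (h v w hvw i) (h' v w hvw i)

theorem Preserves₁.left {P : V → Prop} {Q : W → Prop} (h : Preserves₁ R P Q) :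
    Preserves₂ R (fun x _ => P x) (fun x _ => Q x) :=
  fun v w hvw i _ _ => h v w hvw i

theorem Preserves₂.swap {P : V → V → Prop} {Q : W → W → Prop} (h : Preserves₂ R P Q) :
    Preserves₂ R (fun x y => P y x) (fun x y => Q y x) :=
  fun v w hvw i j hij => h v w hvw j i hij.symm

theorem Preserves₂.and {P P' : V → V → Prop} {Q Q' : W → W → Prop} (h : Preserves₂ R P Q)
    (h' : Preserves₂ R P' Q') :
    Preserves₂ R (fun x y => P x y ∧ P' x y) (fun x y => Q x y ∧ Q' x y) :=
  fun v w hvw i j hij => and_congr (h v w hvw i j hij) (h' v w hvw i j hij)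

/-- A third position acts as an existential quantifier: the bijection carries witnesses to
witnesses. -/
theorem Preserves₂.comp (hR : BackForth R) (hn : 2 < n) {P P' : V → V → Prop}
    {Q Q' : W → W → Prop} (h : Preserves₂ R P Q) (h' : Preserves₂ R P' Q') :
    Preserves₂ R (fun x y => ∃ z, P x z ∧ P' z y) (fun x y => ∃ z, Q x z ∧ Q' z y) := by
  intro v w hvw i j _
  obtain ⟨r, hri, hrj⟩ := Fin.exists_ne_and_ne_of_two_lt i j hn
  obtain ⟨f, hf⟩ := hR v w hvw
  refine f.exists_congr fun z => ?_
  have h1 := h _ _ (hf z r) i r hri.symm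
  have h2 := h' _ _ (hf z r) r j hrj
  simp only [Function.update_self, Function.update_of_ne hri.symm,
    Function.update_of_ne hrj.symm] at h1 h2
  exact and_congr h1 h2

theorem Preserves₂.exists (hR : BackForth R) (hn : 2 < n) {P : V → V → Prop}
    {Q : W → W → Prop} (h : Preserves₂ R P Q) :
    Preserves₁ R (fun x => ∃ z, P x z) (fun x => ∃ z, Q x z) := by
  intro v w hvw i
  obtain ⟨r, hri, -⟩ := Fin.exists_ne_and_ne_of_two_lt i i hn
  obtain ⟨f, hf⟩ := hR v w hvw
  refine f.exists_congr fun z => ?_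
  have h1 := h _ _ (hf z r) i r hri.symm
  simpa only [Function.update_self, Function.update_of_ne hri.symm] using h1

variable {Γ : SimpleGraph V} {Δ : SimpleGraph W}

theorem GraphStrategy.preserves_adj (hR : GraphStrategy Γ Δ R) : Preserves₂ R Γ.Adj Δ.Adj :=
  fun _ _ hvw i j _ => hR.adj_iff hvw i j

theorem GraphStrategy.ncard_neighborSet (hR : GraphStrategy Γ Δ R) (hn : 2 < n)
    {v : Fin n → V} {w : Fin n → W} (hvw : R v w) (i : Fin n) :
    (Γ.neighborSet (v i)).ncard = (Δ.neighborSet (w i)).ncard := by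
  obtain ⟨r, hri, -⟩ := Fin.exists_ne_and_ne_of_two_lt i i hn
  obtain ⟨f, hf⟩ := hR.backForth v w hvw
  have key : ∀ x, Γ.Adj (v i) x ↔ Δ.Adj (w i) (f x) := fun x => by
    simpa [hri.symm] using hR.adj_iff (hf x r) i r
  have : Δ.neighborSet (w i) = Set.image f (Γ.neighborSet (v i)) := by
    ext y
    simp [f.image_eq_preimage_symm, key]
  rw [this, Set.ncard_image_of_injective _ f.injective]

end Preserved

theorem graphStrategy_sameColors {n : ℕ} {V W : Type u} [Fintype V] [Fintype W]
    (Γ : SimpleGraph V) (Δ : SimpleGraph W) :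
    GraphStrategy Γ Δ (SameColors (initGraph (k := n) Γ) (initGraph Δ)) where
  backForth := backForth_sameColors
  eq_iff h i j := (markedGraphIso_iff.1 (initGraph_eq_iff.1 h.initial_eq) i j).1
  adj_iff h i j := (markedGraphIso_iff.1 (initGraph_eq_iff.1 h.initial_eq) i j).2

/-! ### Vertex classes and gadget incidences in terms of degrees and paths -/

namespace Vertex

variable {G : Type u}

/-- The vertex is a group element. -/
def IsElem (v : Vertex G) : Prop := ∃ x, v = .elem x

/-- The middle vertex `b` of the gadget of the pair `x`. -/
def pair (x : Bool → G) : Vertex G := .b (x false) (x true)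

/-- The vertex is the middle vertex of a gadget. -/
def IsPair (v : Vertex G) : Prop := ∃ x, v = pair x

/-- The vertex is neither a group element nor the middle vertex of a gadget. -/
def IsMinor (v : Vertex G) : Prop := ¬ v.IsElem ∧ ¬ v.IsPair

/-- `z` is the first (`s = false`) or second (`s = true`) element of the pair `v`. -/
def IsSide (s : Bool) (z v : Vertex G) : Prop := ∃ x, z = .elem (x s) ∧ v = pair x

/-- `z` is the product of the two elements of the pair `v`. -/
def IsProd [Group G] (z v : Vertex G) : Prop := ∃ x, z = .elem (x false * x true) ∧ v = pair x

@[simp]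
theorem pair_inj {x y : Bool → G} : pair x = pair y ↔ x = y := by
  simp [pair, funext_iff]

@[simp]
theorem isElem_elem (x : G) : (elem x).IsElem := ⟨x, rfl⟩

@[simp]
theorem not_isElem_a (x y : G) : ¬ (a x y).IsElem := fun ⟨_, h⟩ => nomatch h

@[simp]
theorem not_isElem_b (x y : G) : ¬ (b x y).IsElem := fun ⟨_, h⟩ => nomatch h

@[simp]
theorem not_isElem_c (x y : G) : ¬ (c x y).IsElem := fun ⟨_, h⟩ => nomatch h

@[simp]
theorem not_isElem_d (x y : G) : ¬ (d x y).IsElem := fun ⟨_, h⟩ => nomatch h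

@[simp]
theorem isPair_b (x y : G) : (b x y).IsPair := ⟨fun s => cond s y x, rfl⟩

@[simp]
theorem not_isPair_elem (x : G) : ¬ (elem x).IsPair := fun ⟨_, h⟩ => nomatch h

@[simp]
theorem not_isPair_a (x y : G) : ¬ (a x y).IsPair := fun ⟨_, h⟩ => nomatch h

@[simp]
theorem not_isPair_c (x y : G) : ¬ (c x y).IsPair := fun ⟨_, h⟩ => nomatch h

@[simp]
theorem not_isPair_d (x y : G) : ¬ (d x y).IsPair := fun ⟨_, h⟩ => nomatch h

@[simp]
theorem isSide_elem_pair {s : Bool} {z : G} {x : Bool → G} : IsSide s (elem z) (pair x) ↔ z = x s := by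
  constructor
  · rintro ⟨y, hy, hx⟩
    rw [pair_inj.1 hx]
    exact elem.inj hy
  · rintro rfl
    exact ⟨x, rfl, rfl⟩

variable [Group G]

@[simp]
theorem isProd_elem_pair {z : G} {x : Bool → G} :
    IsProd (elem z) (pair x) ↔ z = x false * x true := by
  constructor
  · rintro ⟨y, hy, hx⟩
    rw [pair_inj.1 hx]
    exact elem.inj hy
  · rintro rfl
    exact ⟨x, rfl, rfl⟩

theorem isSide_true_iff {z v : Vertex G} :
    IsSide true z v ↔ (gadgetGraph G).Adj z v ∧ z.IsElem ∧ v.IsPair := by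
  constructor
  · rintro ⟨x, rfl, rfl⟩
    simp [gadgetGraph_adj, pair, Edge]
  · rintro ⟨h, ⟨z, rfl⟩, ⟨x, rfl⟩⟩
    rw [isSide_elem_pair]
    simpa [gadgetGraph_adj, pair, Edge] using h

theorem isSide_false_iff {z v : Vertex G} :
    IsSide false z v ↔ (∃ m, ((gadgetGraph G).Adj z m ∧ m.IsMinor) ∧ (gadgetGraph G).Adj m v) ∧
      z.IsElem ∧ v.IsPair := by
  constructor
  · rintro ⟨x, rfl, rfl⟩
    refine ⟨⟨a (x false) (x true), ?_⟩, ?_⟩ <;> simp [gadgetGraph_adj, pair, Edge, IsMinor]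
  · rintro ⟨⟨m, ⟨h1, h2⟩, h3⟩, ⟨z, rfl⟩, ⟨x, rfl⟩⟩
    rw [isSide_elem_pair]
    cases m <;> simp_all [gadgetGraph_adj, pair, Edge, IsMinor]

/-- The path runs from the product through `d` and `c` to `b`. Requiring minor inner vertices
excludes detours through group elements and other middle vertices. -/
theorem isProd_iff {z v : Vertex G} :
    IsProd z v ↔ (∃ m, (∃ l, ((gadgetGraph G).Adj z l ∧ l.IsMinor) ∧
      (gadgetGraph G).Adj l m ∧ m.IsMinor) ∧ (gadgetGraph G).Adj m v) ∧ z.IsElem ∧ v.IsPair := by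
  constructor
  · rintro ⟨x, rfl, rfl⟩
    refine ⟨⟨c (x false) (x true), ⟨d (x false) (x true), ?_⟩, ?_⟩, ?_⟩ <;>
      simp [gadgetGraph_adj, pair, Edge, IsMinor]
  · rintro ⟨⟨m, ⟨l, ⟨h1, h2⟩, h3, h4⟩, h5⟩, ⟨z, rfl⟩, ⟨x, rfl⟩⟩
    rw [isProd_elem_pair]
    cases l <;> cases m <;> simp_all [gadgetGraph_adj, pair, Edge, IsMinor]

/-- In the trivial group the identity has degree 3, like a middle vertex, so nontriviality is
essential for the classification by degree. -/
theorem ncard_neighborSet_elem [Finite G] [Nontrivial G] (x : G) :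
    4 ≤ ((gadgetGraph G).neighborSet (elem x)).ncard := by
  obtain ⟨y, hy⟩ := exists_ne (1 : G)
  have : Finite (Vertex G) := by
    have := Fintype.ofFinite G
    infer_instance
  have hsub : ({a x 1, a x y, b 1 x, b y x} : Set (Vertex G)) ⊆
      (gadgetGraph G).neighborSet (elem x) := by
    rintro _ (rfl | rfl | rfl | rfl) <;> simp [gadgetGraph_adj, Edge]
  refine le_trans (le_of_eq ?_) (Set.ncard_le_ncard hsub)
  rw [Set.ncard_insert_of_notMem (by simp [hy.symm]), Set.ncard_insert_of_notMem (by simp),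
    Set.ncard_insert_of_notMem (by simp [hy.symm]), Set.ncard_singleton]

theorem ncard_neighborSet_pair (x : Bool → G) :
    ((gadgetGraph G).neighborSet (pair x)).ncard = 3 := by
  have : (gadgetGraph G).neighborSet (pair x) =
      {elem (x true), a (x false) (x true), c (x false) (x true)} := by
    ext v
    cases v <;> simp [gadgetGraph_adj, pair, Edge, eq_comm]
  rw [this, Set.ncard_insert_of_notMem (by simp), Set.ncard_insert_of_notMem (by simp),
    Set.ncard_singleton]

theorem IsMinor.ncard_neighborSet {v : Vertex G} (hv : v.IsMinor) :
    ((gadgetGraph G).neighborSet v).ncard ≤ 2 := by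
  have : ∃ l m, (gadgetGraph G).neighborSet v ⊆ {l, m} := by
    cases v with
    | elem x => exact absurd (isElem_elem x) hv.1
    | a x y =>
      refine ⟨elem x, b x y, fun w hw => ?_⟩
      cases w <;> simp_all [gadgetGraph_adj, Edge]
    | b x y => exact absurd (isPair_b x y) hv.2
    | c x y =>
      refine ⟨b x y, d x y, fun w hw => ?_⟩
      cases w <;> simp_all [gadgetGraph_adj, Edge]
    | d x y =>
      refine ⟨elem (x * y), c x y, fun w hw => ?_⟩
      cases w <;> simp_all [gadgetGraph_adj, Edge]
  obtain ⟨l, m, h⟩ := this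
  exact (Set.ncard_le_ncard h).trans ((Set.ncard_insert_le _ _).trans (by simp))

theorem isElem_iff [Finite G] [Nontrivial G] {v : Vertex G} :
    v.IsElem ↔ 4 ≤ ((gadgetGraph G).neighborSet v).ncard := by
  constructor
  · rintro ⟨x, rfl⟩
    exact ncard_neighborSet_elem x
  · intro h
    by_contra h1
    by_cases h2 : v.IsPair
    · obtain ⟨x, rfl⟩ := h2
      rw [ncard_neighborSet_pair] at h
      omega
    · have := IsMinor.ncard_neighborSet ⟨h1, h2⟩
      omega

theorem isPair_iff [Finite G] [Nontrivial G] {v : Vertex G} :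
    v.IsPair ↔ ((gadgetGraph G).neighborSet v).ncard = 3 := by
  constructor
  · rintro ⟨x, rfl⟩
    exact ncard_neighborSet_pair x
  · intro h
    by_contra h2
    by_cases h1 : v.IsElem
    · have := isElem_iff.1 h1
      omega
    · have := IsMinor.ncard_neighborSet ⟨h1, h2⟩
      omega

end Vertex

/-! ### Version II is bounded by Version III -/

section

open Vertex

variable {n k : ℕ} {G H : Type u} [Group G] [Group H] [Finite G] [Finite H] [Nontrivial G]
  [Nontrivial H] {R : (Fin n → Vertex G) → (Fin n → Vertex H) → Prop}

namespace GraphStrategy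

theorem preserves_isElem (hR : GraphStrategy (gadgetGraph G) (gadgetGraph H) R) (hn : 2 < n) :
    Preserves₁ R IsElem IsElem := fun v w hvw i => by
  rw [isElem_iff, isElem_iff, hR.ncard_neighborSet hn hvw]

theorem preserves_isPair (hR : GraphStrategy (gadgetGraph G) (gadgetGraph H) R) (hn : 2 < n) :
    Preserves₁ R IsPair IsPair := fun v w hvw i => by
  rw [isPair_iff, isPair_iff, hR.ncard_neighborSet hn hvw]

theorem preserves_isMinor (hR : GraphStrategy (gadgetGraph G) (gadgetGraph H) R) (hn : 2 < n) :
    Preserves₁ R IsMinor IsMinor :=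
  (hR.preserves_isElem hn).not.and (hR.preserves_isPair hn).not

theorem preserves_elem_pair (hR : GraphStrategy (gadgetGraph G) (gadgetGraph H) R) (hn : 2 < n) :
    Preserves₂ R (fun z v => z.IsElem ∧ v.IsPair) (fun z v => z.IsElem ∧ v.IsPair) :=
  (hR.preserves_isElem hn).left.and (hR.preserves_isPair hn).left.swap

theorem preserves_adj_minor (hR : GraphStrategy (gadgetGraph G) (gadgetGraph H) R) (hn : 2 < n) :
    Preserves₂ R (fun z m => (gadgetGraph G).Adj z m ∧ m.IsMinor)
      (fun z m => (gadgetGraph H).Adj z m ∧ m.IsMinor) :=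
  hR.preserves_adj.and (hR.preserves_isMinor hn).left.swap

theorem preserves_isSide (hR : GraphStrategy (gadgetGraph G) (gadgetGraph H) R) (hn : 2 < n)
    (s : Bool) : Preserves₂ R (IsSide s) (IsSide s) := by
  cases s
  · have := ((hR.preserves_adj_minor hn).comp hR.backForth hn hR.preserves_adj).and
      (hR.preserves_elem_pair hn)
    simpa only [Preserves₂, isSide_false_iff] using this
  · have := hR.preserves_adj.and (hR.preserves_elem_pair hn)
    simpa only [Preserves₂, isSide_true_iff] using this

theorem preserves_isProd (hR : GraphStrategy (gadgetGraph G) (gadgetGraph H) R) (hn : 2 < n) :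
    Preserves₂ R IsProd IsProd := by
  have := (((hR.preserves_adj_minor hn).comp hR.backForth hn (hR.preserves_adj_minor hn)).comp
    hR.backForth hn hR.preserves_adj).and (hR.preserves_elem_pair hn)
  simpa only [Preserves₂, isProd_iff] using this

/-- The identity is the only idempotent of a group, which the pair with both sides and product equal
to `z` expresses. -/
theorem preserves_eq_one (hR : GraphStrategy (gadgetGraph G) (gadgetGraph H) R) (hn : 2 < n) :
    Preserves₁ R (fun z => z = elem 1) (fun z => z = elem 1) := by
  have key : ∀ {K : Type u} [Group K] (z : Vertex K),
      z = elem 1 ↔ ∃ v, IsSide false z v ∧ IsSide true z v ∧ IsProd z v := by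
    intro K _ z
    constructor
    · rintro rfl
      exact ⟨pair fun _ => 1, by simp⟩
    · rintro ⟨_, ⟨x, rfl, rfl⟩, h1, h2⟩
      rw [isSide_elem_pair] at h1
      rw [isProd_elem_pair, ← h1] at h2
      rw [left_eq_mul.1 h2]
  have := ((hR.preserves_isSide hn false).and ((hR.preserves_isSide hn true).and
    (hR.preserves_isProd hn))).exists hR.backForth hn
  simpa only [Preserves₁, key] using this

end GraphStrategy

/-- At the position and side `e j` the tuple `v` of vertices contains the group element `g j`. -/
def Marks {K : Type u} (e : Fin k → Fin n × Bool) (g : Fin k → K) (v : Fin n → Vertex K) : Prop :=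
  ∀ j, IsSide (e j).2 (elem (g j)) (v (e j).1)

theorem Marks.update {K : Type u} {e : Fin k → Fin n × Bool} {g : Fin k → K} {v : Fin n → Vertex K}
    (h : Marks e g v) {p : Fin n} (hp : ∀ j, (e j).1 ≠ p) (x : Vertex K) :
    Marks e g (Function.update v p x) := fun j => by
  simpa [Function.update_of_ne (hp j)] using h j

namespace GraphStrategy

/-- Version III detects which words in the marked elements a given element is the value of. -/
theorem eq_lift_iff (hR : GraphStrategy (gadgetGraph G) (gadgetGraph H) R) (hn : 2 < n)
    {e : Fin k → Fin n × Bool} {p q : Fin n} (hpq : p ≠ q) (hp : ∀ j, (e j).1 ≠ p)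
    (hq : ∀ j, (e j).1 ≠ q) {g : Fin k → G} {h : Fin k → H} (r : FreeGroup (Fin k)) :
    ∀ v w, R v w → Marks e g v → Marks e h w →
      (v p = elem (FreeGroup.lift g r) ↔ w p = elem (FreeGroup.lift h r)) := by
  -- a property of elements that is preserved at `p` is preserved for the sides and the product of a
  -- pair at `q`
  have step : ∀ (P : Vertex G → Vertex G → Prop) (Q : Vertex H → Vertex H → Prop),
      Preserves₂ R P Q → ∀ (x : G) (y : H),
      (∀ v w, R v w → Marks e g v → Marks e h w → (v p = elem x ↔ w p = elem y)) →
      ∀ v w, R v w → Marks e g v → Marks e h w →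
        ((∃ z, P z (v q) ∧ z = elem x) ↔ ∃ z, Q z (w q) ∧ z = elem y) := by
    intro P Q hPQ x y hxy v w hvw hv hw
    obtain ⟨f, hf⟩ := hR.backForth v w hvw
    refine f.exists_congr fun z => ?_
    have h1 := hPQ _ _ (hf z p) p q hpq
    have h2 := hxy _ _ (hf z p) (hv.update hp _) (hw.update hp _)
    simp only [Function.update_self, Function.update_of_ne hpq.symm] at h1 h2
    exact and_congr h1 h2
  have key_mul : ∀ {K : Type u} [Group K] (z : Vertex K) (x y : K), z = elem (x * y) ↔
      ∃ v, IsProd z v ∧ (∃ t, IsSide false t v ∧ t = elem x) ∧ ∃ t, IsSide true t v ∧ t = elem y := by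
    intro K _ z x y
    constructor
    · rintro rfl
      exact ⟨pair fun s => cond s y x, by simp⟩
    · rintro ⟨_, ⟨x, rfl, rfl⟩, h1, h2⟩
      simp at h1 h2
      rw [h1, h2]
  have key_inv : ∀ {K : Type u} [Group K] (z : Vertex K) (x : K), z = elem x⁻¹ ↔
      ∃ v, IsSide false z v ∧ (∃ t, IsSide true t v ∧ t = elem x) ∧ ∃ t, IsProd t v ∧ t = elem 1 := by
    intro K _ z x
    constructor
    · rintro rfl
      exact ⟨pair fun s => cond s x x⁻¹, by simp⟩
    · rintro ⟨_, ⟨x, rfl, rfl⟩, h1, h2⟩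
      simp at h1 h2
      rw [h1, eq_inv_of_mul_eq_one_left h2.symm]
  have hS := hR.preserves_isSide hn
  have hM := hR.preserves_isProd hn
  have h1 := hR.preserves_eq_one hn
  induction r using FreeGroup.induction_on with
  | C1 => exact fun v w hvw _ _ => by simpa using h1 v w hvw p
  | of j =>
    intro v w hvw hv hw
    have key : ∀ {K : Type u} (z u : Vertex K) (x : K), IsSide (e j).2 (elem x) u →
        (z = elem x ↔ IsSide (e j).2 z u) := by
      rintro K z u x ⟨y, hy, rfl⟩
      obtain rfl := elem.inj hy
      constructor
      · rintro rfl
        exact ⟨y, rfl, rfl⟩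
      · rintro ⟨y', rfl, h⟩
        rw [pair_inj.1 h]
    simp only [FreeGroup.lift_apply_of]
    rw [key _ _ _ (hv j), key _ _ _ (hw j)]
    exact hS _ v w hvw _ _ (hp j).symm
  | inv_of j ih =>
    intro v w hvw hv hw
    rw [map_inv, map_inv, key_inv, key_inv]
    obtain ⟨f, hf⟩ := hR.backForth v w hvw
    refine f.exists_congr fun D => ?_
    have a1 := hS false _ _ (hf D q) p q hpq
    have a2 := step _ _ (hS true) _ _ ih _ _ (hf D q) (hv.update hq _) (hw.update hq _)
    have a3 := step _ _ hM 1 1 (fun v w hvw _ _ => h1 v w hvw p) _ _ (hf D q) (hv.update hq _)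
      (hw.update hq _)
    simp only [Function.update_self, Function.update_of_ne hpq] at a1 a2 a3
    exact and_congr a1 (and_congr a2 a3)
  | mul r r' ih ih' =>
    intro v w hvw hv hw
    rw [map_mul, map_mul, key_mul, key_mul]
    obtain ⟨f, hf⟩ := hR.backForth v w hvw
    refine f.exists_congr fun D => ?_
    have a1 := hM _ _ (hf D q) p q hpq
    have a2 := step _ _ (hS false) _ _ ih _ _ (hf D q) (hv.update hq _) (hw.update hq _)
    have a3 := step _ _ (hS true) _ _ ih' _ _ (hf D q) (hv.update hq _) (hw.update hq _)
    simp only [Function.update_self, Function.update_of_ne hpq] at a1 a2 a3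
    exact and_congr a1 (and_congr a2 a3)

theorem markedGroupIso (hR : GraphStrategy (gadgetGraph G) (gadgetGraph H) R) (hn : 2 < n)
    {e : Fin k → Fin n × Bool} {p q : Fin n} (hpq : p ≠ q) (hp : ∀ j, (e j).1 ≠ p)
    (hq : ∀ j, (e j).1 ≠ q) {g : Fin k → G} {h : Fin k → H} {v : Fin n → Vertex G}
    {w : Fin n → Vertex H} (hvw : R v w) (hv : Marks e g v) (hw : Marks e h w) :
    MarkedGroupIso g h := by
  refine markedGroupIso_of_relations fun r => ?_
  obtain ⟨f, hf⟩ := hR.backForth v w hvw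
  -- With the value of `r` placed at `p`, the answer is the value of `r` in `H`, and being the
  -- identity is preserved.
  have h1 := hR.preserves_eq_one hn _ _ (hf (elem (FreeGroup.lift g r)) p) p
  have h2 := hR.eq_lift_iff hn hpq hp hq r _ _ (hf (elem (FreeGroup.lift g r)) p)
    (hv.update hp _) (hw.update hp _)
  simp only [Function.update_self, true_iff, elem.injEq] at h1 h2
  rw [h1, h2, elem.injEq]

/-- A bijection of the vertices given by the strategy maps group elements to group elements. -/
theorem exists_equiv_elem (hR : GraphStrategy (gadgetGraph G) (gadgetGraph H) R) (hn : 2 < n)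
    {v : Fin n → Vertex G} {w : Fin n → Vertex H} (hvw : R v w) :
    ∃ f : G ≃ H, ∀ x p, R (Function.update v p (elem x)) (Function.update w p (elem (f x))) := by
  obtain ⟨F, hF⟩ := hR.backForth v w hvw
  have hE : ∀ x, x.IsElem ↔ (F x).IsElem := fun x => by
    have := hR.preserves_isElem hn _ _ (hF x ⟨0, by omega⟩) ⟨0, by omega⟩
    simpa using this
  choose f hf using fun x => (hE (elem x)).1 (isElem_elem x)
  choose f' hf' using fun y => (hE (F.symm (elem y))).2 (by simp)
  refine ⟨⟨f, f', fun x => ?_, fun y => ?_⟩, fun x p => ?_⟩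
  · rw [← elem.injEq, ← hf', ← hf, F.symm_apply_apply]
  · rw [← elem.injEq, ← hf, ← hf', F.apply_symm_apply]
  · have := hF (elem x) p
    rwa [hf] at this

/-- To change one side of the pair at `i`, the new element goes to `p` and the modified pair to `q`.
Incidence with `p` determines one side of the answer, the side shared with the old pair at `i`
determines the other, and the new pair is then copied from `q` to `i`. -/
theorem backForth_marks (hR : GraphStrategy (gadgetGraph G) (gadgetGraph H) R) (hn : 2 < n)
    {e : Fin k → Fin n × Bool} (he : e.Injective) {p q : Fin n} (hpq : p ≠ q)
    (hp : ∀ j, (e j).1 ≠ p) (hq : ∀ j, (e j).1 ≠ q) :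
    BackForth fun (g : Fin k → G) (h : Fin k → H) => ∃ v w, R v w ∧ Marks e g v ∧ Marks e h w := by
  rintro g h ⟨v, w, hvw, hv, hw⟩
  obtain ⟨f, hf⟩ := hR.exists_equiv_elem hn hvw
  refine ⟨f, fun x j => ?_⟩
  rcases hij : e j with ⟨i, s⟩
  have hip : i ≠ p := by simpa [hij] using hp j
  have hiq : i ≠ q := by simpa [hij] using hq j
  obtain ⟨y, -, hvi⟩ := hv j
  obtain ⟨z, -, hwi⟩ := hw j
  rw [hij] at hvi hwi
  obtain ⟨F, hF⟩ := hR.backForth _ _ (hf x p)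
  have hD := hF (pair (Function.update y s x)) q
  obtain ⟨y', hy'⟩ : (F (pair (Function.update y s x))).IsPair := by
    have := hR.preserves_isPair hn _ _ hD q
    simp only [Function.update_self] at this
    exact this.1 ⟨_, rfl⟩
  rw [hy'] at hD
  have hs : y' s = f x := by
    have := hR.preserves_isSide hn s _ _ hD p q hpq
    simp only [Function.update_self, Function.update_of_ne hpq, isSide_elem_pair, true_iff] at this
    exact this.symm
  have hs' : y' (!s) = z (!s) := by
    have := ((hR.preserves_isSide hn (!s)).swap.comp hR.backForth hn
      (hR.preserves_isSide hn (!s))) _ _ hD q i hiq.symm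
    simp only [Function.update_self, Function.update_of_ne hip, Function.update_of_ne hiq,
      hvi, hwi] at this
    obtain ⟨t, ⟨t', rfl, ht⟩, ht'⟩ := this.1 ⟨elem (y (!s)), by simp⟩
    rw [pair_inj.1 ht]
    exact isSide_elem_pair.1 ht'
  obtain ⟨F', hF'⟩ := hR.backForth _ _ hD
  have hN := hF' (pair (Function.update y s x)) i
  have hFN : F' (pair (Function.update y s x)) = pair y' := by
    have := hR.eq_iff hN i q
    simpa [Function.update_of_ne hiq.symm] using this
  rw [hFN] at hN
  have marks : ∀ {K : Type u} {g : Fin k → K} {v : Fin n → Vertex K} {y y' : Bool → K} {x : K},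
      Marks e g v → v i = pair y → y' s = x → y' (!s) = y (!s) →
      Marks e (Function.update g j x) (Function.update v i (pair y')) := by
    intro K g v y y' x hv hvi h1 h2 j'
    by_cases hj : j' = j
    · subst hj
      simp [hij, h1]
    · have hgj := hv j'
      rw [Function.update_of_ne hj]
      by_cases hi : (e j').1 = i
      · have hsj : (e j').2 = !s := by
          have : (e j').2 ≠ s := fun h => hj (he (by rw [hij, ← hi, ← h]))
          revert this
          cases (e j').2 <;> cases s <;> simp
        rw [hi, hvi, hsj, isSide_elem_pair] at hgj
        rw [hi, hsj, Function.update_self, isSide_elem_pair, h2, hgj]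
      · rwa [Function.update_of_ne hi]
  refine ⟨_, _, hN, marks (y := y) ((hv.update hp _).update hq _) ?_ ?_ ?_,
    marks ((hw.update hp _).update hq _) ?_ hs hs'⟩
  · simp [hip, hiq, hvi]
  · simp
  · simp
  · simp [hip, hiq, hwi]

end GraphStrategy

end

/-! ### Degenerate cases and the final comparison with Version III -/

theorem wlEquiv_II_of_subsingleton {k : ℕ} {G H : Type u} [Group G] [Group H] [Fintype G]
    [Fintype H] (f : G ≃ H) (h : Subsingleton G ∨ k = 0) : WLEquiv .II k G H := by
  have hbf : BackForth fun (_ : Fin k → G) (_ : Fin k → H) => True := fun _ _ _ => ⟨f, by simp⟩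
  obtain ⟨F, -⟩ := hbf.exists_equiv (g := 1) (h := 1) trivial
  refine ⟨F, fun g => (hbf.sameColors (fun _ _ _ => ?_) trivial).sameFinalColor⟩
  refine initII_eq_iff.2 (markedGroupIso_of_relations fun r => ?_)
  rcases h with h | rfl
  · have := f.symm.subsingleton
    exact iff_of_true (Subsingleton.elim _ _) (Subsingleton.elim _ _)
  · rw [Subsingleton.elim r 1, map_one, map_one]
    simp

theorem wlLe_II_III {k m : ℕ} (hk : k ≤ 2 * m) : WLLe.{u} .II k .III (m + 2) := by
  rintro G H _ _ _ _ ⟨E, hE⟩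
  have hcard : Fintype.card G = Fintype.card H := by
    have := Fintype.card_congr E
    simp only [Fintype.card_pi, Finset.prod_const, Finset.card_univ, Fintype.card_fin] at this
    exact Nat.pow_left_injective (by omega) this
  have f := Fintype.equivOfCardEq hcard
  rcases subsingleton_or_nontrivial G with hG | hG
  · exact wlEquiv_II_of_subsingleton f (.inl hG)
  rcases Nat.eq_zero_or_pos m with rfl | hm
  · exact wlEquiv_II_of_subsingleton f (.inr (by omega))
  have hH : Nontrivial H := f.symm.nontrivial
  have hn : 2 < m + 2 := by omega
  have hR := graphStrategy_sameColors (n := m + 2) (gadgetGraph G) (gadgetGraph H)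
  -- Entries `2i` and `2i + 1` share the pair at position `i < m`; positions `m` and `m + 1` remain
  -- as workspace.
  let e : Fin k → Fin (m + 2) × Bool := fun j =>
    (⟨j / 2, by have := j.2; omega⟩, decide (j.1 % 2 = 1))
  have he : e.Injective := by
    intro i j h
    rw [Prod.mk.injEq, Fin.mk.injEq, decide_eq_decide] at h
    exact Fin.ext (by omega)
  have hp : ∀ j, (e j).1 ≠ ⟨m, by omega⟩ := fun j h => by
    have : j.1 / 2 = m := congrArg Fin.val h
    have := j.2
    omega
  have hq : ∀ j, (e j).1 ≠ ⟨m + 1, by omega⟩ := fun j h => by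
    have : j.1 / 2 = m + 1 := congrArg Fin.val h
    have := j.2
    omega
  have hpq : (⟨m, by omega⟩ : Fin (m + 2)) ≠ ⟨m + 1, by omega⟩ := by simp
  have hbf := hR.backForth_marks hn he hpq hp hq
  obtain ⟨F, hF⟩ := hR.backForth.exists_equiv (hE 1).sameColors
  -- The game starts with the pair `(1, 1)` everywhere, answered by some pairs `y i`; their entries
  -- need not be identified.
  have hstart := hF fun _ => Vertex.pair fun _ => 1
  choose y hy using fun i => (hR.preserves_isPair hn _ _ hstart i).1 ⟨_, rfl⟩
  obtain ⟨E', hE'⟩ := hbf.exists_equiv (g := fun _ => 1) (h := fun j => y (e j).1 (e j).2)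
    ⟨_, _, hstart, fun j => by simp, fun j => by simp [hy]⟩
  refine ⟨E', fun g => (hbf.sameColors ?_ (hE' g)).sameFinalColor⟩
  rintro g h ⟨v, w, hvw, hv, hw⟩
  exact initII_eq_iff.2 (hR.markedGroupIso hn hpq hp hq hvw hv hw)

end GroupWL

/-- In natural-number division, `(k + 1) / 2` is `⌈k/2⌉` and `k / 2` is `⌊k/2⌋`. For even `k` both are
`k/2`, and the third and the fourth part say the same. -/
theorem mainTheorem2 (k : ℕ) :
    GroupWL.WLLe.{u} .I k .II k ∧
    GroupWL.WLLe.{u} .II k .III ((k + 1) / 2 + 2) ∧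
    GroupWL.WLLe.{u} .III ((k + 1) / 2 + 2) .I (2 * ((k + 1) / 2) + 5) ∧
    GroupWL.WLLe.{u} .III (k / 2 + 2) .I (k + 5) :=
  ⟨GroupWL.wlLe_I_II k, GroupWL.wlLe_II_III (by omega), GroupWL.wlLe_III_I (by omega),
    GroupWL.wlLe_III_I (by omega)⟩
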